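/- **Theorem (Coordinate invariance of the regularity conditions).** *Setting.* Let $(\mathcal X,\mathrm{vol})$ be a $\sigma$-finite measure space (for example a Riemannian manifold with its volume measure). Let $\Omega$ be a parameter manifold that admits global coordinate systems $\phi,\psi$, that is, homeomorphisms of $\Omega$ onto open subsets of $\mathbb R^k$; assume that $\phi$ and $\psi$ are related by a $C^2$ coordinate transformation, i.e. $\psi\circ\phi^{-1}$ and $\phi\circ\psi^{-1}$ are twice continuously differentiable. For $n\ge 1$ and $\theta\in\Omega$ let $p(x^n\mid\theta)$ be a strictly positive probability density on $\mathcal X^n$ with respect to $\mathrm{vol}^n$ (for example $\prod_i p(x_i\mid\theta)$), twice continuously differentiable in $\phi(\theta)$, with law $P^n_\theta$. Let $\hat\theta(x^n)$ be a maximum likelihood estimator: a measurable map into $\Omega$ which maximizes $\theta\mapsto p(x^n\mid\theta)$ over $\Omega$ whenever a maximizer exists. Let $\Theta\subseteq\Omega$, and assume that for every $\theta\in\Theta$ and $n \geq 1$ the density may be differentiated once in $\phi(\theta)$ under the integral sign: $\partial p(x^n\mid\theta)/\partial\phi(\theta)$ is $\mathrm{vol}^n$-integrable and its integral is $\frac{\partial}{\partial\phi(\theta)}\int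 p(x^n\mid\theta)\,d\mathrm{vol}^n$. Put $$I_\phi(x^n,\theta)=-\frac1n\,\frac{\partial^2\log p(x^n\mid\theta)}{\partial\phi(\theta)\,\partial\phi(\theta)^\top},\qquad I_\phi(\theta)=\lim_{n\to\infty}E^n_\theta\left[I_\phi(x^n,\theta)\right].$$ *Regularity conditions in $\phi$.* For all $\theta\in\Theta$ the expectations ($n\ge1$) and the limit defining $I_\phi(\theta)$ exist, and 1. $\Theta$ is compact, and there are constants $0<c_1\le c_2<\infty$ with $c_1\le\det I_\phi(\theta)\le c_2$ for all $\theta\in\Theta$. 2. $\theta\mapsto I_\phi(\theta)$ is continuous on $\Theta$. 3. $\int_{\Theta}\sqrt{\det I_\phi(\theta)}\,d\phi(\theta)<\infty$. 4. (Uniform asymptotic normality of the MLE.) $I_\phi(\theta)$ is positive definite for every $\theta\in\Theta$, and for every $\varepsilon>0$ there is $N$ such that for all $n\ge N$, all $\theta\in\Theta$ and all measurable $A\subseteq\mathbb R^k$ whose boundary has Lebesgue measure zero, $$\left|P^n_\theta\left(\sqrt n\,\bigl(\phi(\hat\theta(x^n))-\phi(\theta)\bigr)\in A\right)-P\left(Z_\theta\in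 A\right)\right|<\varepsilon,\qquad Z_\theta\sim\mathcal N\left(0,I_\phi(\theta)^{-1}\right).$$ 5. There is a positive definite matrix $C_0$ such that for all $n\ge1$ and all $x^n$ which have a maximum likelihood estimate and for which $\hat\theta(x^n)\in\Theta$, one has $I_\phi(x^n,\hat\theta(x^n))<C_0$ (i.e. $C_0-I_\phi(x^n,\hat\theta(x^n))$ is positive definite). *Claim.* If these regularity conditions hold in the coordinate system $\phi$, then they also hold in the coordinate system $\psi$ (with possibly different constants $c_1,c_2,N,C_0$). -/

import Mathlib

open MeasureTheory ProbabilityTheory Filter Topology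

namespace MDL

noncomputable section

/-- A global coordinate system on the parameter manifold `Ω`: a homeomorphism of all of `Ω` onto
an open subset (`φ.target`) of `ℝ^k`. -/
def IsGlobalCoord {Ω : Type*} [TopologicalSpace Ω] {k : ℕ}
    (φ : OpenPartialHomeomorph Ω (EuclideanSpace ℝ (Fin k))) : Prop :=
  φ.source = Set.univ

/-- The two coordinate systems are related by a twice continuously differentiable coordinate
transformation: both transition maps are of class `C²`. -/
structure IsC2Related {Ω : Type*} [TopologicalSpace Ω] {k : ℕ}
    (φ ψ : OpenPartialHomeomorph Ω (EuclideanSpace ℝ (Fin k))) : Prop where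
  contDiffOn_forward : ContDiffOn ℝ 2 (ψ ∘ φ.symm) φ.target
  contDiffOn_backward : ContDiffOn ℝ 2 (φ ∘ ψ.symm) ψ.target

section Model

variable {X Ω : Type*} [MeasurableSpace X] [TopologicalSpace Ω] {k : ℕ}

/-- `p n x θ` is a density `p(xⁿ | θ)` with respect to the product volume `volⁿ` on `Xⁿ`
(for i.i.d. data, `p n x θ = ∏ i, p₁ (x i) θ`). It is strictly positive and twice continuously
differentiable in the coordinates `φ` of the parameter, so that its log-likelihood Hessian is
meaningful. -/
structure IsStatModel (vol : Measure X) (p : (n : ℕ) → (Fin n → X) → Ω → ℝ)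
    (φ : OpenPartialHomeomorph Ω (EuclideanSpace ℝ (Fin k))) : Prop where
  measurable : ∀ n, 1 ≤ n → ∀ θ, Measurable fun x => p n x θ
  pos : ∀ n, 1 ≤ n → ∀ x θ, 0 < p n x θ
  lintegral_eq_one : ∀ n, 1 ≤ n → ∀ θ,
    ∫⁻ x, ENNReal.ofReal (p n x θ) ∂(Measure.pi fun _ : Fin n => vol) = 1
  contDiffOn : ∀ n, 1 ≤ n → ∀ x, ContDiffOn ℝ 2 (fun y => p n x (φ.symm y)) φ.target

/-- The density may be differentiated once with respect to the parameter under the integral sign,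
at every point of `Θ`. -/
structure DiffUnderIntegral (vol : Measure X) (p : (n : ℕ) → (Fin n → X) → Ω → ℝ)
    (φ : OpenPartialHomeomorph Ω (EuclideanSpace ℝ (Fin k))) (Θ : Set Ω) : Prop where
  integrable : ∀ n, 1 ≤ n → ∀ θ ∈ Θ,
    Integrable (fun x => fderiv ℝ (fun y => p n x (φ.symm y)) (φ θ))
      (Measure.pi fun _ : Fin n => vol)
  integral_fderiv : ∀ n, 1 ≤ n → ∀ θ ∈ Θ,
    ∫ x, fderiv ℝ (fun y => p n x (φ.symm y)) (φ θ) ∂(Measure.pi fun _ : Fin n => vol)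
      = fderiv ℝ (fun y => ∫ x, p n x (φ.symm y) ∂(Measure.pi fun _ : Fin n => vol)) (φ θ)

/-- The law of the data `xⁿ` under the parameter `θ`. -/
def dataLaw (vol : Measure X) (p : (n : ℕ) → (Fin n → X) → Ω → ℝ) (n : ℕ) (θ : Ω) :
    Measure (Fin n → X) :=
  (Measure.pi fun _ : Fin n => vol).withDensity fun x => ENNReal.ofReal (p n x θ)

/-- `θ` is a maximum likelihood estimate for the data `x`. -/
def IsMLEAt (p : (n : ℕ) → (Fin n → X) → Ω → ℝ) (n : ℕ) (x : Fin n → X) (θ : Ω) : Prop :=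
  ∀ θ', p n x θ' ≤ p n x θ

/-- `θhat` is a maximum likelihood estimator: a measurable map which maximizes the likelihood over
the whole parameter manifold for all data for which a maximizer exists (where there is none, as
with a single observation of a normal law of unknown mean and variance, its value is
arbitrary). -/
structure IsMLE [MeasurableSpace Ω] (p : (n : ℕ) → (Fin n → X) → Ω → ℝ)
    (θhat : (n : ℕ) → (Fin n → X) → Ω) : Prop where
  measurable : ∀ n, 1 ≤ n → Measurable (θhat n)
  isMLEAt : ∀ n, 1 ≤ n → ∀ x, (∃ θ, IsMLEAt p n x θ) → IsMLEAt p n x (θhat n x)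

/-- The empirical information matrix
`I_φ(xⁿ, θ) = -(1/n) ∂² log p(xⁿ | θ) / ∂φ(θ) ∂φ(θ)ᵀ`. -/
def empInfo (p : (n : ℕ) → (Fin n → X) → Ω → ℝ)
    (φ : OpenPartialHomeomorph Ω (EuclideanSpace ℝ (Fin k))) (n : ℕ) (x : Fin n → X) (θ : Ω) :
    Matrix (Fin k) (Fin k) ℝ :=
  Matrix.of fun i j =>
    -(1 / (n : ℝ)) *
      fderiv ℝ (fderiv ℝ fun y => Real.log (p n x (φ.symm y))) (φ θ)
        (EuclideanSpace.single i 1) (EuclideanSpace.single j 1)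

/-- The expectation `E_θⁿ [I_φ(xⁿ, θ)]`, entry by entry. -/
def meanInfo (vol : Measure X) (p : (n : ℕ) → (Fin n → X) → Ω → ℝ)
    (φ : OpenPartialHomeomorph Ω (EuclideanSpace ℝ (Fin k))) (n : ℕ) (θ : Ω) :
    Matrix (Fin k) (Fin k) ℝ :=
  Matrix.of fun i j => ∫ x, empInfo p φ n x θ i j ∂(dataLaw vol p n θ)

/-- The Fisher information matrix `I_φ(θ) = lim_{n → ∞} E_θⁿ [I_φ(xⁿ, θ)]`. -/
def fisherInfo (vol : Measure X) (p : (n : ℕ) → (Fin n → X) → Ω → ℝ)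
    (φ : OpenPartialHomeomorph Ω (EuclideanSpace ℝ (Fin k))) (θ : Ω) :
    Matrix (Fin k) (Fin k) ℝ :=
  limUnder atTop fun n => meanInfo vol p φ n θ

/-- The expectations and the limit that define `I_φ(θ)` exist. -/
structure FisherInfoExists (vol : Measure X) (p : (n : ℕ) → (Fin n → X) → Ω → ℝ)
    (φ : OpenPartialHomeomorph Ω (EuclideanSpace ℝ (Fin k))) (θ : Ω) : Prop where
  integrable : ∀ n, 1 ≤ n → ∀ i j,
    Integrable (fun x => empInfo p φ n x θ i j) (dataLaw vol p n θ)
  exists_limit : ∃ L, Tendsto (fun n => meanInfo vol p φ n θ) atTop (𝓝 L)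

/-- Uniform validity over `Θ` of the asymptotic normality of the estimator: the probabilities of
all measurable sets `A ⊆ ℝ^k` with Lebesgue-null boundary converge uniformly in `θ ∈ Θ` and in
`A`. For `N(0, I_φ(θ)⁻¹)` to make sense, `I_φ(θ)` has to be positive definite. -/
structure UniformAsymptoticNormality (vol : Measure X) (p : (n : ℕ) → (Fin n → X) → Ω → ℝ)
    (θhat : (n : ℕ) → (Fin n → X) → Ω)
    (φ : OpenPartialHomeomorph Ω (EuclideanSpace ℝ (Fin k))) (Θ : Set Ω) : Prop where
  posDef : ∀ θ ∈ Θ, (fisherInfo vol p φ θ).PosDef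
  uniform : ∀ ε : ℝ, 0 < ε → ∃ N : ℕ, ∀ n : ℕ, ∀ θ ∈ Θ, ∀ A : Set (EuclideanSpace ℝ (Fin k)),
    MeasurableSet A → volume (frontier A) = 0 → N ≤ n →
      |(dataLaw vol p n θ).real {x | √(n : ℝ) • (φ (θhat n x) - φ θ) ∈ A}
        - (multivariateGaussian 0 (fisherInfo vol p φ θ)⁻¹).real A| < ε

/-- The five regularity conditions, expressed in the coordinate system `φ`, together with the
existence of the Fisher information matrix which they presuppose. -/
structure RegularityConditions [MeasurableSpace Ω] (vol : Measure X)
    (p : (n : ℕ) → (Fin n → X) → Ω → ℝ) (θhat : (n : ℕ) → (Fin n → X) → Ω)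
    (φ : OpenPartialHomeomorph Ω (EuclideanSpace ℝ (Fin k))) (Θ : Set Ω) : Prop where
  /-- The Fisher information matrix is well defined on `Θ`. -/
  fisherInfo_exists : ∀ θ ∈ Θ, FisherInfoExists vol p φ θ
  /-- Condition 1, compactness. -/
  isCompact : IsCompact Θ
  /-- Condition 1, bounds on the determinant. -/
  det_bounds : ∃ c₁ c₂ : ℝ, 0 < c₁ ∧ ∀ θ ∈ Θ,
    c₁ ≤ (fisherInfo vol p φ θ).det ∧ (fisherInfo vol p φ θ).det ≤ c₂
  /-- Condition 2. -/
  continuousOn : ContinuousOn (fisherInfo vol p φ) Θ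
  /-- Condition 3: `∫_Θ √|I_φ(θ)| dφ(θ) < ∞`, where `dφ(θ)` is Lebesgue measure in the
  coordinates `φ`, pulled back to `Ω`. -/
  integrableOn : IntegrableOn (fun θ => √((fisherInfo vol p φ θ).det)) Θ
    ((volume : Measure (EuclideanSpace ℝ (Fin k))).comap φ)
  /-- Condition 4. -/
  asymptoticNormality : UniformAsymptoticNormality vol p θhat φ Θ
  /-- Condition 5: the empirical information matrix at the maximum likelihood estimate is bounded
  in the Loewner order, for all data whose maximum likelihood estimate belongs to `Θ`. -/
  hessian_bound : ∃ C₀ : Matrix (Fin k) (Fin k) ℝ, C₀.PosDef ∧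
    ∀ n, 1 ≤ n → ∀ x : Fin n → X, IsMLEAt p n x (θhat n x) → θhat n x ∈ Θ →
      (C₀ - empInfo p φ n x (θhat n x)).PosDef

end Model

end

end MDL

/-! Write `J` for the Jacobian `∂φ/∂ψ`. By the chain rule the empirical information in `ψ` is `Jᵀ
I_φ J` plus a term linear in the score. The score has mean zero, because `∫ p = 1` may be
differentiated under the integral, so the Fisher information satisfies `I_ψ = Jᵀ I_φ J`
(`fisherInfo_eq`). The score also vanishes pointwise at a maximum likelihood estimate
(`empInfo_eq_of_isMLEAt`). As `J` is continuous and invertible and `Θ` is compact, conditions 1, 2,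
3 and 5 follow by continuity, once `I_ψ` is known to be positive definite.

Condition 4 is the hard part, since a delta method must be uniform in `θ` and in the test set `A`.
With `t = √n` and `f = ψ ∘ φ⁻¹`, the rescaled `ψ`-error is the image of the rescaled `φ`-error under
`H z = t (f (φ θ + z / t) - ψ θ)`. Condition 4 in `φ` is uniform over sets, so it applies to `B' ∩
H⁻¹ A`, with `B'` a large ellipsoid, although this set depends on `n` and `θ`; its boundary is null
by `volume_frontier_rescaled`. It remains to compare two Gaussian probabilities. After whitening,
`H` is `C¹`-close to the identity on a fixed ball (`rescaled_close_id`), and such a map changes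
standard Gaussian probabilities by little, uniformly in `A` (`exists_stdGaussian_perturbation`). -/

theorem ContinuousOn.measurableSet_inter_preimage {α β : Type*} [TopologicalSpace α]
    [MeasurableSpace α] [OpensMeasurableSpace α] [TopologicalSpace β] [MeasurableSpace β]
    [BorelSpace β] {f : α → β} {s : Set α} (hf : ContinuousOn f s) (hs : MeasurableSet s)
    {t : Set β} (ht : MeasurableSet t) : MeasurableSet (s ∩ f ⁻¹' t) := by
  have h1 : MeasurableSet ((s.domRestrict f) ⁻¹' t) := hf.domRestrict.measurable ht
  have h2 := (MeasurableEmbedding.subtype_coe hs).measurableSet_image.2 h1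
  convert h2 using 1
  ext x
  simp [and_comm]

/-! ### The standard Gaussian measure under `C¹`-small perturbations. -/

section StdGaussian

variable {E : Type*} [NormedAddCommGroup E] [InnerProductSpace ℝ E] [FiniteDimensional ℝ E]
  [MeasurableSpace E] [BorelSpace E]

/-- The standard Gaussian measure has a continuous density with respect to Lebesgue measure. -/
theorem exists_continuous_density_stdGaussian :
    ∃ g : E → ℝ, Continuous g ∧ (∀ x, 0 ≤ g x) ∧ Integrable g ∧
      stdGaussian E = (volume : Measure E).withDensity fun x => ENNReal.ofReal (g x) := by
  set K : ℝ := ∫ x : E, Real.exp (-(‖x‖ ^ 2 / 2)) with hK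
  set P : ℂ := (Real.pi / (1 / 2 : ℂ)) ^ (Module.finrank ℝ E / 2 : ℂ) with hP
  have hb : 0 < (1 / 2 : ℂ).re := by norm_num
  have hP0 : P ≠ 0 := by
    rw [hP, Complex.cpow_ne_zero_iff]
    left
    simp [Real.pi_ne_zero]
  have key : ∀ t : E, ∫ x : E, Complex.exp (-(1 / 2 : ℂ) * ‖x‖ ^ 2 + Complex.I * inner ℝ t x) =
      P * Complex.exp (-‖t‖ ^ 2 / 2) := by
    intro t
    rw [GaussianFourier.integral_cexp_neg_mul_sq_norm_add hb]
    congr 2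
    rw [Complex.I_sq]; ring
  -- The Fourier integral at `t = 0` identifies the normalizing constant.
  have hKP : (K : ℂ) = P := by
    have := key 0
    simp only [norm_zero, inner_zero_left] at this
    simp only [Complex.ofReal_zero, mul_zero, add_zero, ne_eq, OfNat.ofNat_ne_zero,
      not_false_eq_true, zero_pow, neg_zero, zero_div, Complex.exp_zero, mul_one] at this
    rw [← this, hK, ← integral_complex_ofReal]
    congr 1; ext x; push_cast; congr 1; ring
  have hK0 : K ≠ 0 := by
    intro h; apply hP0; rw [← hKP, h]; simp
  have hKpos : 0 < K := lt_of_le_of_ne (integral_nonneg fun x => (Real.exp_pos _).le) hK0.symm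
  -- A non-integrable function has Bochner integral `0`, so `K ≠ 0` already yields integrability.
  have hint : Integrable (fun x : E => Real.exp (-(‖x‖ ^ 2 / 2))) := by
    by_contra h; exact hK0 (integral_undef h)
  have hint' : Integrable (fun x : E => K⁻¹ * Real.exp (-(‖x‖ ^ 2 / 2))) := hint.const_mul _
  have hnn : ∀ x : E, 0 ≤ K⁻¹ * Real.exp (-(‖x‖ ^ 2 / 2)) := fun x => by positivity
  have hcont : Continuous fun x : E => K⁻¹ * Real.exp (-(‖x‖ ^ 2 / 2)) := by fun_prop
  refine ⟨fun x => K⁻¹ * Real.exp (-(‖x‖ ^ 2 / 2)), hcont, hnn, hint', ?_⟩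
  have : IsFiniteMeasure ((volume : Measure E).withDensity fun x =>
      ENNReal.ofReal (K⁻¹ * Real.exp (-(‖x‖ ^ 2 / 2)))) :=
    isFiniteMeasure_withDensity_ofReal hint'.2
  apply Measure.ext_of_charFun
  ext t
  rw [charFun_stdGaussian, charFun_apply, integral_withDensity_eq_integral_toReal_smul
    (by fun_prop) (by simp)]
  have : ∀ x : E, (ENNReal.ofReal (K⁻¹ * Real.exp (-(‖x‖ ^ 2 / 2)))).toReal •
      Complex.exp (inner ℝ x t * Complex.I) =
      P⁻¹ * Complex.exp (-(1 / 2 : ℂ) * ‖x‖ ^ 2 + Complex.I * inner ℝ t x) := by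
    intro x
    rw [ENNReal.toReal_ofReal (hnn x), ← hKP, Complex.real_smul, Complex.exp_add,
      real_inner_comm]
    push_cast
    rw [mul_assoc]
    congr 3
    · ring_nf
    · ring_nf
  simp_rw [this]
  rw [integral_const_mul, key, inv_mul_cancel_left₀ hP0]

/-- A map that is `C¹`-close to the identity on a large ball almost preserves the standard
Gaussian measure, uniformly over all measurable sets. -/
theorem exists_stdGaussian_perturbation {ε : ℝ} (hε : 0 < ε) :
    ∃ R δ : ℝ, 0 < R ∧ 0 < δ ∧
      (stdGaussian E).real (Metric.ball 0 R)ᶜ ≤ ε ∧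
      ∀ (k : E → E) (k' : E → E →L[ℝ] E),
        (∀ x ∈ Metric.ball (0 : E) R, HasFDerivAt k (k' x) x) →
        Set.InjOn k (Metric.ball 0 R) →
        (∀ x ∈ Metric.ball (0 : E) R, ‖k x - x‖ ≤ δ) →
        (∀ x ∈ Metric.ball (0 : E) R, ‖k' x - ContinuousLinearMap.id ℝ E‖ ≤ δ) →
        ∀ A : Set E, MeasurableSet A →
          |(stdGaussian E).real (Metric.ball 0 R ∩ k ⁻¹' A) - (stdGaussian E).real A| ≤ ε := by
  obtain ⟨g, hgc, hg0, hgi, hγ⟩ := exists_continuous_density_stdGaussian (E := E)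
  have hreal : ∀ s : Set E, MeasurableSet s → (stdGaussian E).real s = ∫ x in s, g x := by
    intro s hs
    rw [Measure.real, hγ, withDensity_apply _ hs,
      integral_eq_lintegral_of_nonneg_ae (ae_of_all _ hg0) hgc.aestronglyMeasurable]
  obtain ⟨R, hR, hRball⟩ : ∃ R : ℝ, 0 < R ∧ (stdGaussian E).real (Metric.ball 0 R)ᶜ ≤ ε / 3 := by
    have h1 : Tendsto (fun n : ℕ => (stdGaussian E) (Metric.ball 0 (n + 1 : ℝ))ᶜ) atTop (𝓝 0) := by
      have := tendsto_measure_iInter_atTop (μ := stdGaussian E)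
        (s := fun n : ℕ => (Metric.ball (0 : E) (n + 1 : ℝ))ᶜ)
        (fun n => measurableSet_ball.compl.nullMeasurableSet)
        (fun m n hmn => Set.compl_subset_compl.2 (Metric.ball_subset_ball (by gcongr)))
        ⟨0, measure_ne_top _ _⟩
      have h0 : ⋂ n : ℕ, (Metric.ball (0 : E) (n + 1 : ℝ))ᶜ = ∅ := by
        ext x
        simp only [Set.mem_iInter, Set.mem_compl_iff, Metric.mem_ball, dist_zero_right, not_lt,
          Set.mem_empty_iff_false, iff_false, not_forall, not_le]
        obtain ⟨n, hn⟩ := exists_nat_gt ‖x‖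
        exact ⟨n, by linarith⟩
      rwa [h0, measure_empty] at this
    have h2 := (ENNReal.tendsto_toReal ENNReal.zero_ne_top).comp h1
    obtain ⟨n, hn⟩ := ((h2.eventually_lt_const (u := ε / 3) (by simpa using by positivity))).exists
    exact ⟨n + 1, by positivity, hn.le⟩
  set B : Set E := Metric.ball 0 R with hB
  have hBm : MeasurableSet B := measurableSet_ball
  set V : ℝ := (volume : Measure E).real B with hV
  have hV0 : 0 ≤ V := measureReal_nonneg
  -- joint uniform continuity of `(x, L) ↦ g x * |det L|`
  set F : E × (E →L[ℝ] E) → ℝ := fun q => g q.1 * |q.2.det| with hF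
  have hFc : Continuous F := by
    refine (hgc.comp continuous_fst).mul (continuous_abs.comp ?_)
    exact ContinuousLinearMap.continuous_det.comp continuous_snd
  set η : ℝ := ε / 3 / (V + 1) with hη
  have hη0 : 0 < η := by positivity
  -- Points of this compact set are compared with arbitrary nearby points, so `k x` may leave the
  -- ball.
  have hK : IsCompact (Metric.closedBall (0 : E) R ×ˢ {ContinuousLinearMap.id ℝ E}) :=
    (isCompact_closedBall 0 R).prod isCompact_singleton
  have hunif := hK.uniformContinuousAt_of_continuousAt F (fun a _ => hFc.continuousAt)
    (Metric.dist_mem_uniformity hη0)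
  obtain ⟨δ, hδ, hδF⟩ := Metric.mem_uniformity_dist.1 hunif
  refine ⟨R, δ / 2, hR, by positivity, hRball.trans (by linarith), ?_⟩
  intro k k' hk hinj hk1 hk2 A hA
  have hest : ∀ x ∈ B, |g (k x) * |(k' x).det| - g x| ≤ η := by
    intro x hx
    have h1 : dist (x, ContinuousLinearMap.id ℝ E) (k x, k' x) < δ := by
      rw [Prod.dist_eq, max_lt_iff, dist_comm x, dist_comm (ContinuousLinearMap.id ℝ E),
        dist_eq_norm, dist_eq_norm]
      exact ⟨(hk1 x hx).trans_lt (by linarith), (hk2 x hx).trans_lt (by linarith)⟩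
    have h2 := hδF h1 ⟨Metric.ball_subset_closedBall hx, rfl⟩
    simp only [Set.mem_ofPred_eq, hF, Real.dist_eq] at h2
    rw [abs_sub_comm]
    have hid : (ContinuousLinearMap.id ℝ E).det = 1 := LinearMap.det_id
    simpa [hid] using h2.le
  have hcon : ContinuousOn k B := fun x hx => (hk x hx).continuousAt.continuousWithinAt
  -- Change of variables: both measures are integrals over `B ∩ k ⁻¹' A`, with integrands `g` and
  -- `|det k'| • g ∘ k` differing by at most `η`.
  have hmain : ∀ A : Set E, MeasurableSet A →
      |(stdGaussian E).real (B ∩ k ⁻¹' A) - (stdGaussian E).real (k '' B ∩ A)| ≤ ε / 3 := by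
    intro A hA
    have himage : k '' B ∩ A = k '' (B ∩ k ⁻¹' A) := (Set.image_inter_preimage k B A).symm
    set s := B ∩ k ⁻¹' A with hs
    have hsm : MeasurableSet s := hcon.measurableSet_inter_preimage hBm hA
    have hsub : s ⊆ B := Set.inter_subset_left
    have hder : ∀ x ∈ s, HasFDerivWithinAt k (k' x) s x := fun x hx =>
      (hk x (hsub hx)).hasFDerivWithinAt
    have hinjs := hinj.mono hsub
    have him : MeasurableSet (k '' s) :=
      measurable_image_of_fderivWithin hsm hder hinjs
    rw [himage, hreal _ hsm, hreal _ him,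
      integral_image_eq_integral_abs_det_fderiv_smul volume hsm hder hinjs]
    have hi : IntegrableOn (fun x => |(k' x).det| • g (k x)) s :=
      (integrableOn_image_iff_integrableOn_abs_det_fderiv_smul volume hsm hder hinjs g).1
        hgi.integrableOn
    rw [← integral_sub hgi.integrableOn hi]
    have hfin : volume s < ⊤ := (measure_mono hsub).trans_lt measure_ball_lt_top
    rw [← Real.norm_eq_abs]
    calc ‖∫ x in s, (g x - |(k' x).det| • g (k x))‖
        ≤ η * (volume : Measure E).real s := by
          refine norm_setIntegral_le_of_norm_le_const hfin fun x hx => ?_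
          rw [Real.norm_eq_abs, abs_sub_comm, smul_eq_mul, mul_comm]
          exact hest x (hsub hx)
      _ ≤ η * V := by
          gcongr
          exact measureReal_mono hsub measure_ball_lt_top.ne
      _ ≤ η * (V + 1) := by gcongr; linarith
      _ = ε / 3 := by rw [hη]; field_simp
  have himB : MeasurableSet (k '' B) :=
    measurable_image_of_fderivWithin hBm (fun x hx => (hk x hx).hasFDerivWithinAt) hinj
  have h1 := hmain A hA
  -- The case `A = univ` shows that `k '' B` misses mass at most `2ε/3`, which bounds the part of
  -- `A` outside `k '' B`.
  have h2 := hmain Set.univ MeasurableSet.univ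
  simp only [Set.preimage_univ, Set.inter_univ] at h2
  have h3 := probReal_compl_eq_one_sub (μ := stdGaussian E) hBm
  have h4 := measureReal_inter_add_sdiff (μ := stdGaussian E) (s := A) himB
  rw [Set.inter_comm] at h4
  have h5 : (stdGaussian E).real (A \ k '' B) ≤ (stdGaussian E).real (k '' B)ᶜ :=
    measureReal_mono (fun x hx => hx.2)
  rw [probReal_compl_eq_one_sub (μ := stdGaussian E) himB] at h5
  have h6 : 0 ≤ (stdGaussian E).real (A \ k '' B) := measureReal_nonneg
  rw [abs_le] at *
  constructor <;> linarith

end StdGaussian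

/-! ### Centred Gaussians as linear images of the standard one. -/

section MultivariateGaussian

open Matrix

variable {ι : Type*} [Fintype ι] [DecidableEq ι]

theorem map_toEuclideanCLM_stdGaussian (T : Matrix ι ι ℝ) :
    (stdGaussian (EuclideanSpace ℝ ι)).map (toEuclideanCLM (𝕜 := ℝ) T) =
      multivariateGaussian 0 (T * Tᵀ) := by
  have hT : (T * Tᵀ).PosSemidef := by
    simpa [conjTranspose_eq_transpose_of_trivial] using posSemidef_self_mul_conjTranspose T
  have := Measure.isProbabilityMeasure_map (μ := stdGaussian (EuclideanSpace ℝ ι))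
    (f := toEuclideanCLM (𝕜 := ℝ) T) (by fun_prop)
  apply Measure.ext_of_charFun
  ext t
  have h : ∀ x : EuclideanSpace ℝ ι, inner ℝ (toEuclideanCLM (𝕜 := ℝ) T x) t =
      inner ℝ x (toEuclideanCLM (𝕜 := ℝ) Tᵀ t) := by
    intro x
    rw [real_inner_comm, inner_toEuclideanCLM, inner_toEuclideanCLM, dotProduct_mulVec,
      ← mulVec_transpose, dotProduct_comm]
  rw [charFun_multivariateGaussian hT, charFun_apply, integral_map (by fun_prop) (by fun_prop)]
  simp_rw [h]
  rw [← charFun_apply, charFun_stdGaussian, ← Complex.ofReal_pow, ← real_inner_self_eq_norm_sq,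
    ← h, real_inner_comm, ← ContinuousLinearMap.comp_apply, ← ContinuousLinearMap.mul_def,
    ← map_mul, inner_toEuclideanCLM]
  simp [neg_div]

theorem real_multivariateGaussian_inv {M S : Matrix ι ι ℝ} (hS : S * Sᵀ = M⁻¹)
    (A : Set (EuclideanSpace ℝ ι)) (hA : MeasurableSet A) :
    (multivariateGaussian 0 M⁻¹).real A =
      (stdGaussian (EuclideanSpace ℝ ι)).real (toEuclideanCLM (𝕜 := ℝ) S ⁻¹' A) := by
  rw [← hS, ← map_toEuclideanCLM_stdGaussian, measureReal_def, measureReal_def, Measure.map_apply (by fun_prop) hA]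

end MultivariateGaussian

/-! ### The chain rule for second derivatives. -/

section Calculus

variable {E F : Type*} [NormedAddCommGroup E] [NormedSpace ℝ E]
  [NormedAddCommGroup F] [NormedSpace ℝ F]

/-- The last term is what prevents a Hessian from being a tensor; it drops out wherever `fderiv ℝ f
(g x)` vanishes. -/
theorem fderiv_fderiv_comp_apply {f : F → ℝ} {g : E → F} {x : E}
    (hf : ContDiffAt ℝ 2 f (g x)) (hg : ContDiffAt ℝ 2 g x) (a b : E) :
    fderiv ℝ (fderiv ℝ (f ∘ g)) x a b =
      fderiv ℝ (fderiv ℝ f) (g x) (fderiv ℝ g x a) (fderiv ℝ g x b) +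
        fderiv ℝ f (g x) (fderiv ℝ (fderiv ℝ g) x a b) := by
  have hg1 : ∀ᶠ y in 𝓝 x, DifferentiableAt ℝ g y :=
    (hg.eventually (by simp)).mono fun y hy => hy.differentiableAt (by simp)
  have hf1 : ∀ᶠ y in 𝓝 x, DifferentiableAt ℝ f (g y) :=
    hg.continuousAt.eventually
      ((hf.eventually (by simp)).mono fun y hy => hy.differentiableAt (by simp))
  have h1 : fderiv ℝ (f ∘ g) =ᶠ[𝓝 x] fun y => (fderiv ℝ f (g y)).comp (fderiv ℝ g y) := by
    filter_upwards [hg1, hf1] with y h1 h2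
    exact fderiv_comp y h2 h1
  have hf2 : DifferentiableAt ℝ (fderiv ℝ f) (g x) :=
    (hf.fderiv_right (m := 1) (by norm_num)).differentiableAt (by simp)
  have hg2 : DifferentiableAt ℝ (fderiv ℝ g) x :=
    (hg.fderiv_right (m := 1) (by norm_num)).differentiableAt (by simp)
  have h2 := (hf2.hasFDerivAt.comp x (hg.differentiableAt (by simp)).hasFDerivAt).clm_comp
    hg2.hasFDerivAt
  rw [h1.fderiv_eq]
  have h3 := h2.fderiv
  simp only [Function.comp_apply] at h3
  erw [h3]
  simp [add_comm]

end Calculus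

/-! ### Transformation laws for the score and the information matrices. -/

namespace MDL

open Matrix

noncomputable section

variable {X Ω : Type*} [MeasurableSpace X] [TopologicalSpace Ω] {k : ℕ}

/-- The Jacobian matrix `∂φ / ∂ψ` of a change of coordinates. -/
def jacobian (φ ψ : OpenPartialHomeomorph Ω (EuclideanSpace ℝ (Fin k))) (θ : Ω) :
    Matrix (Fin k) (Fin k) ℝ :=
  (toEuclideanCLM (𝕜 := ℝ)).symm (fderiv ℝ (φ ∘ ψ.symm) (ψ θ))

variable {φ ψ : OpenPartialHomeomorph Ω (EuclideanSpace ℝ (Fin k))}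

theorem toEuclideanCLM_jacobian (θ : Ω) :
    toEuclideanCLM (𝕜 := ℝ) (jacobian φ ψ θ) = fderiv ℝ (φ ∘ ψ.symm) (ψ θ) :=
  (toEuclideanCLM (𝕜 := ℝ)).apply_symm_apply _

theorem IsC2Related.symm (h : IsC2Related φ ψ) : IsC2Related ψ φ :=
  ⟨h.contDiffOn_backward, h.contDiffOn_forward⟩

theorem IsGlobalCoord.mem_target (hφ : IsGlobalCoord φ) (θ : Ω) : φ θ ∈ φ.target :=
  φ.map_source (hφ ▸ Set.mem_univ θ)

theorem IsGlobalCoord.symm_apply (hφ : IsGlobalCoord φ) (θ : Ω) : φ.symm (φ θ) = θ :=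
  φ.left_inv (hφ ▸ Set.mem_univ θ)

theorem IsGlobalCoord.continuous (hφ : IsGlobalCoord φ) : Continuous φ :=
  continuousOn_univ.1 (hφ ▸ φ.continuousOn)

theorem IsC2Related.contDiffAt (h : IsC2Related φ ψ) {y : EuclideanSpace ℝ (Fin k)}
    (hy : y ∈ ψ.target) : ContDiffAt ℝ 2 (φ ∘ ψ.symm) y :=
  h.contDiffOn_backward.contDiffAt (ψ.open_target.mem_nhds hy)

theorem continuous_jacobian (hψ : IsGlobalCoord ψ) (h : IsC2Related φ ψ) :
    Continuous (jacobian φ ψ) := by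
  have h1 : ContinuousOn (fderiv ℝ (φ ∘ ψ.symm)) ψ.target :=
    h.contDiffOn_backward.continuousOn_fderiv_of_isOpen ψ.open_target (by norm_num)
  have h2 : Continuous fun θ => fderiv ℝ (φ ∘ ψ.symm) (ψ θ) :=
    h1.comp_continuous hψ.continuous hψ.mem_target
  have h3 : Continuous (toEuclideanCLM (n := Fin k) (𝕜 := ℝ)).symm :=
    LinearMap.continuous_of_finiteDimensional
      ((toEuclideanCLM (n := Fin k) (𝕜 := ℝ)).symm.toAlgEquiv.toLinearMap)
  exact h3.comp h2

theorem jacobian_mul_jacobian (hφ : IsGlobalCoord φ) (hψ : IsGlobalCoord ψ)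
    (h : IsC2Related φ ψ) (θ : Ω) : jacobian φ ψ θ * jacobian ψ φ θ = 1 := by
  apply EquivLike.injective (toEuclideanCLM (n := Fin k) (𝕜 := ℝ))
  rw [map_mul, map_one, toEuclideanCLM_jacobian, toEuclideanCLM_jacobian,
    ContinuousLinearMap.mul_def]
  have h1 : (φ ∘ ψ.symm) ∘ (ψ ∘ φ.symm) =ᶠ[𝓝 (φ θ)] id := by
    filter_upwards [φ.open_target.mem_nhds (hφ.mem_target θ)] with y hy
    simp [hψ.symm_apply, φ.right_inv hy]
  have h3 : (ψ ∘ φ.symm) (φ θ) = ψ θ := by simp [hφ.symm_apply]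
  have h2 := fderiv_comp (φ θ) (g := φ ∘ ψ.symm) (f := ψ ∘ φ.symm)
    (by rw [h3]; exact (h.contDiffAt (hψ.mem_target θ)).differentiableAt (by simp))
    ((h.symm.contDiffAt (hφ.mem_target θ)).differentiableAt (by simp))
  rw [h1.fderiv_eq, fderiv_id, h3] at h2
  rw [← h2]
  rfl

variable {vol : Measure X} {p : (n : ℕ) → (Fin n → X) → Ω → ℝ}

theorem IsStatModel.contDiffAt_log (hp : IsStatModel vol p φ) {n : ℕ} (hn : 1 ≤ n)
    (x : Fin n → X) {y : EuclideanSpace ℝ (Fin k)} (hy : y ∈ φ.target) :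
    ContDiffAt ℝ 2 (fun y => Real.log (p n x (φ.symm y))) y :=
  ((hp.contDiffOn n hn x).contDiffAt (φ.open_target.mem_nhds hy)).log (hp.pos n hn x _).ne'

/-- The transformation law of the empirical information matrix under a change of coordinates. -/
theorem empInfo_eq (hφ : IsGlobalCoord φ) (hψ : IsGlobalCoord ψ) (h : IsC2Related φ ψ)
    (hp : IsStatModel vol p φ) {n : ℕ} (hn : 1 ≤ n) (x : Fin n → X) (θ : Ω) :
    empInfo p ψ n x θ = (jacobian φ ψ θ)ᵀ * empInfo p φ n x θ * jacobian φ ψ θ +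
      Matrix.of fun i j => -(1 / (n : ℝ)) *
        fderiv ℝ (fun y => Real.log (p n x (φ.symm y))) (φ θ)
          (fderiv ℝ (fderiv ℝ (φ ∘ ψ.symm)) (ψ θ)
            (EuclideanSpace.single i 1) (EuclideanSpace.single j 1)) := by
  have hg : (φ ∘ ψ.symm) (ψ θ) = φ θ := by simp [hψ.symm_apply]
  have h1 : (fun y => Real.log (p n x (ψ.symm y))) =
      (fun y => Real.log (p n x (φ.symm y))) ∘ (φ ∘ ψ.symm) := by
    ext y; simp [hφ.symm_apply]
  have hJ : ∀ i, fderiv ℝ (φ ∘ ψ.symm) (ψ θ) (EuclideanSpace.single i 1) =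
      ∑ a, jacobian φ ψ θ a i • EuclideanSpace.single a (1 : ℝ) := by
    intro i
    rw [← toEuclideanCLM_jacobian]
    ext a
    simp [ofLp_toEuclideanCLM, Finset.sum_apply, Pi.single_apply]
  ext i j
  rw [empInfo, Matrix.add_apply, Matrix.of_apply, Matrix.of_apply, h1,
    fderiv_fderiv_comp_apply (hg ▸ hp.contDiffAt_log hn x (hφ.mem_target θ))
      (h.contDiffAt (hψ.mem_target θ)), hg, mul_add]
  congr 1
  rw [hJ, hJ]
  simp only [map_sum, map_smul, _root_.sum_apply, _root_.smul_apply,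
    Matrix.mul_apply, Matrix.transpose_apply, empInfo, Matrix.of_apply, Finset.sum_mul,
    Finset.mul_sum, smul_eq_mul]
  refine Finset.sum_congr rfl fun a _ => Finset.sum_congr rfl fun b _ => ?_
  ring

/-- At an interior maximum of the likelihood the score vanishes, so the empirical information
matrix transforms as a quadratic form. -/
theorem empInfo_eq_of_isMLEAt (hφ : IsGlobalCoord φ) (hψ : IsGlobalCoord ψ) (h : IsC2Related φ ψ)
    (hp : IsStatModel vol p φ) {n : ℕ} (hn : 1 ≤ n) (x : Fin n → X) {θ : Ω}
    (hθ : IsMLEAt p n x θ) :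
    empInfo p ψ n x θ = (jacobian φ ψ θ)ᵀ * empInfo p φ n x θ * jacobian φ ψ θ := by
  have h0 : fderiv ℝ (fun y => Real.log (p n x (φ.symm y))) (φ θ) = 0 := by
    -- The likelihood bound holds for every `y`, even off `φ.target`, because `θ` maximizes over all
    -- of `Ω`.
    apply IsLocalMax.fderiv_eq_zero
    refine Eventually.of_forall fun y => ?_
    simp only [hφ.symm_apply]
    exact Real.log_le_log (hp.pos n hn x _) (hθ _)
  rw [empInfo_eq hφ hψ h hp hn, h0]
  ext i j
  simp

theorem IsStatModel.integral_eq_one (hp : IsStatModel vol p φ) {n : ℕ} (hn : 1 ≤ n) (θ : Ω) :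
    ∫ x, p n x θ ∂(Measure.pi fun _ : Fin n => vol) = 1 := by
  rw [integral_eq_lintegral_of_nonneg_ae (ae_of_all _ fun x => (hp.pos n hn x θ).le)
    (hp.measurable n hn θ).aestronglyMeasurable, hp.lintegral_eq_one n hn θ]
  simp

theorem IsStatModel.isProbabilityMeasure_dataLaw (hp : IsStatModel vol p φ) {n : ℕ} (hn : 1 ≤ n)
    (θ : Ω) : IsProbabilityMeasure (dataLaw vol p n θ) := by
  refine ⟨?_⟩
  rw [dataLaw, withDensity_apply _ MeasurableSet.univ, Measure.restrict_univ,
    hp.lintegral_eq_one n hn θ]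

/-- The identity `p ∇ log p = ∇ p`, in the form produced by `withDensity`; it moves integrals of the
score from the data law to the product volume. -/
theorem smul_fderiv_log (hφ : IsGlobalCoord φ) (hp : IsStatModel vol p φ) {n : ℕ} (hn : 1 ≤ n)
    (θ : Ω) (x : Fin n → X) :
    (ENNReal.ofReal (p n x θ)).toReal • fderiv ℝ (fun y => Real.log (p n x (φ.symm y))) (φ θ) =
      fderiv ℝ (fun y => p n x (φ.symm y)) (φ θ) := by
  have hd : DifferentiableAt ℝ (fun y => p n x (φ.symm y)) (φ θ) :=
    ((hp.contDiffOn n hn x).contDiffAt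
      (φ.open_target.mem_nhds (hφ.mem_target θ))).differentiableAt (by simp)
  rw [fderiv.log hd (hp.pos n hn x _).ne', hφ.symm_apply,
    ENNReal.toReal_ofReal (hp.pos n hn x θ).le, smul_smul,
    mul_inv_cancel₀ (hp.pos n hn x θ).ne', one_smul]

theorem integrable_score (hφ : IsGlobalCoord φ) (hp : IsStatModel vol p φ) {Θ : Set Ω}
    (hdiff : DiffUnderIntegral vol p φ Θ) {n : ℕ} (hn : 1 ≤ n) {θ : Ω} (hθ : θ ∈ Θ) :
    Integrable (fun x => fderiv ℝ (fun y => Real.log (p n x (φ.symm y))) (φ θ))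
      (dataLaw vol p n θ) := by
  rw [dataLaw, integrable_withDensity_iff_integrable_smul'
    (hp.measurable n hn θ).ennreal_ofReal (by simp)]
  simp_rw [smul_fderiv_log hφ hp hn]
  exact hdiff.integrable n hn θ hθ

/-- The mean score is the derivative of the total mass, which is constantly `1`. -/
theorem integral_score (hφ : IsGlobalCoord φ) (hp : IsStatModel vol p φ) {Θ : Set Ω}
    (hdiff : DiffUnderIntegral vol p φ Θ) {n : ℕ} (hn : 1 ≤ n) {θ : Ω} (hθ : θ ∈ Θ) :
    ∫ x, fderiv ℝ (fun y => Real.log (p n x (φ.symm y))) (φ θ) ∂(dataLaw vol p n θ) = 0 := by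
  rw [dataLaw, integral_withDensity_eq_integral_toReal_smul
    (hp.measurable n hn θ).ennreal_ofReal (by simp)]
  simp_rw [smul_fderiv_log hφ hp hn]
  rw [hdiff.integral_fderiv n hn θ hθ]
  simp_rw [hp.integral_eq_one hn]
  simp

section Information

variable {Θ : Set Ω} (hφ : IsGlobalCoord φ) (hψ : IsGlobalCoord ψ) (h : IsC2Related φ ψ)
  (hp : IsStatModel vol p φ) (hdiff : DiffUnderIntegral vol p φ Θ) {θ : Ω} (hθ : θ ∈ Θ)
  (hI : FisherInfoExists vol p φ θ)

include hφ hψ h hp hdiff hθ hI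

theorem integrable_empInfo {n : ℕ} (hn : 1 ≤ n) (i j : Fin k) :
    Integrable (fun x => empInfo p ψ n x θ i j) (dataLaw vol p n θ) := by
  simp_rw [empInfo_eq hφ hψ h hp hn, Matrix.add_apply, Matrix.mul_apply, Matrix.of_apply]
  refine Integrable.add ?_ (((integrable_score hφ hp hdiff hn hθ).apply_continuousLinearMap
    _).const_mul _)
  exact integrable_finsetSum _ fun b _ => (integrable_finsetSum _ fun a _ =>
    (hI.integrable n hn a b).const_mul _).mul_const _

theorem meanInfo_eq {n : ℕ} (hn : 1 ≤ n) :
    meanInfo vol p ψ n θ = (jacobian φ ψ θ)ᵀ * meanInfo vol p φ n θ * jacobian φ ψ θ := by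
  have hs := integrable_score hφ hp hdiff hn hθ
  ext i j
  simp_rw [meanInfo, Matrix.of_apply, empInfo_eq hφ hψ h hp hn, Matrix.add_apply,
    Matrix.mul_apply, Matrix.of_apply]
  have h1 : ∀ a b, Integrable (fun x => (jacobian φ ψ θ)ᵀ i a * empInfo p φ n x θ a b)
      (dataLaw vol p n θ) := fun a b => (hI.integrable n hn a b).const_mul _
  rw [integral_add _ ((hs.apply_continuousLinearMap _).const_mul _), integral_const_mul,
    ← ContinuousLinearMap.integral_apply hs, integral_score hφ hp hdiff hn hθ,
    integral_finsetSum]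
  · simp_rw [integral_mul_const]
    simp only [_root_.zero_apply, mul_zero, add_zero]
    refine Finset.sum_congr rfl fun b _ => ?_
    rw [integral_finsetSum _ fun a _ => h1 a b]
    simp_rw [integral_const_mul]
  · exact fun b _ => (integrable_finsetSum _ fun a _ => h1 a b).mul_const _
  · exact integrable_finsetSum _ fun b _ => (integrable_finsetSum _ fun a _ => h1 a b).mul_const _

theorem tendsto_meanInfo :
    Tendsto (fun n => meanInfo vol p ψ n θ) atTop
      (𝓝 ((jacobian φ ψ θ)ᵀ * fisherInfo vol p φ θ * jacobian φ ψ θ)) := by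
  have h1 : Tendsto (fun n => meanInfo vol p φ n θ) atTop (𝓝 (fisherInfo vol p φ θ)) :=
    tendsto_nhds_limUnder hI.exists_limit
  have h2 : Continuous fun M : Matrix (Fin k) (Fin k) ℝ =>
      (jacobian φ ψ θ)ᵀ * M * jacobian φ ψ θ := by fun_prop
  refine ((h2.tendsto _).comp h1).congr' ?_
  filter_upwards [eventually_ge_atTop 1] with n hn
  exact (meanInfo_eq hφ hψ h hp hdiff hθ hI hn).symm

theorem fisherInfoExists_of_isC2Related : FisherInfoExists vol p ψ θ :=
  ⟨fun _ hn => integrable_empInfo hφ hψ h hp hdiff hθ hI hn,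
    ⟨_, tendsto_meanInfo hφ hψ h hp hdiff hθ hI⟩⟩

/-- The transformation law of the Fisher information matrix. -/
theorem fisherInfo_eq :
    fisherInfo vol p ψ θ = (jacobian φ ψ θ)ᵀ * fisherInfo vol p φ θ * jacobian φ ψ θ :=
  (tendsto_meanInfo hφ hψ h hp hdiff hθ hI).limUnder_eq

end Information

end

end MDL

/-! ### Uniform matrix bounds and integrability on compact sets. -/

namespace MDL

open Matrix

noncomputable section

section MatrixBounds

variable {ι α : Type*} [Fintype ι] [DecidableEq ι] [TopologicalSpace α] {s : Set α}

theorem exists_norm_toEuclideanCLM_le {M : α → Matrix ι ι ℝ} (hs : IsCompact s)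
    (hM : ContinuousOn M s) :
    ∃ C : ℝ, 0 < C ∧ ∀ a ∈ s, ‖toEuclideanCLM (𝕜 := ℝ) (M a)‖ ≤ C := by
  have h3 : Continuous (toEuclideanCLM (n := ι) (𝕜 := ℝ)) :=
    LinearMap.continuous_of_finiteDimensional
      ((toEuclideanCLM (n := ι) (𝕜 := ℝ)).toAlgEquiv.toLinearMap)
  obtain ⟨C, hC⟩ := hs.exists_bound_of_continuousOn (h3.comp_continuousOn hM)
  exact ⟨max C 1, by positivity, fun a ha => (hC a ha).trans (le_max_left _ _)⟩

/-- Cauchy–Schwarz. It replaces a `θ`-dependent Loewner bound by a constant one. -/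
theorem posSemidef_smul_one_sub {Q : Matrix ι ι ℝ} (hQ : Q.IsHermitian) {c : ℝ}
    (hc : ‖toEuclideanCLM (𝕜 := ℝ) Q‖ ≤ c) : (c • (1 : Matrix ι ι ℝ) - Q).PosSemidef := by
  refine PosSemidef.of_dotProduct_mulVec_nonneg ?_ fun x => ?_
  · exact (isHermitian_one.smul (IsSelfAdjoint.all c)).sub hQ
  · set v : EuclideanSpace ℝ ι := WithLp.toLp 2 x
    have h1 : inner ℝ v (toEuclideanCLM (𝕜 := ℝ) Q v) ≤ c * ‖v‖ ^ 2 := by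
      refine (real_inner_le_norm _ _).trans ?_
      have := (toEuclideanCLM (𝕜 := ℝ) Q).le_of_opNorm_le hc v
      nlinarith [norm_nonneg v]
    rw [inner_toEuclideanCLM, ← real_inner_self_eq_norm_sq] at h1
    have h2 : inner ℝ v v = x ⬝ᵥ x := by
      rw [EuclideanSpace.inner_eq_star_dotProduct]; rfl
    rw [h2] at h1
    simp only [star_trivial, sub_mulVec, smul_mulVec, one_mulVec, dotProduct_sub,
      dotProduct_smul, smul_eq_mul]
    exact sub_nonneg.2 h1

theorem continuousOn_matrix_inv {M : α → Matrix ι ι ℝ} (hM : ContinuousOn M s)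
    (h0 : ∀ a ∈ s, (M a).det ≠ 0) : ContinuousOn (fun a => (M a)⁻¹) s := by
  simp_rw [Matrix.inv_def, Ring.inverse_eq_inv']
  have h1 : Continuous fun M : Matrix ι ι ℝ => M.det := continuous_id.matrix_det
  have h2 : Continuous fun M : Matrix ι ι ℝ => M.adjugate := continuous_id.matrix_adjugate
  exact ((h1.comp_continuousOn hM).inv₀ h0).smul (h2.comp_continuousOn hM)

open scoped MatrixOrder in
/-- A square root of the inverse of a positive definite matrix, with control of the operator norms
of the root and of its inverse. -/
theorem exists_mul_transpose_eq_inv {M : Matrix ι ι ℝ} (hM : M.PosDef) :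
    ∃ S : Matrix ι ι ℝ, IsUnit S.det ∧ S * Sᵀ = M⁻¹ ∧
      ‖toEuclideanCLM (𝕜 := ℝ) S‖ ^ 2 = ‖toEuclideanCLM (𝕜 := ℝ) M⁻¹‖ ∧
      ‖toEuclideanCLM (𝕜 := ℝ) S⁻¹‖ ^ 2 = ‖toEuclideanCLM (𝕜 := ℝ) M‖ := by
  obtain ⟨B, hB⟩ := CStarAlgebra.nonneg_iff_eq_star_mul_self.1 hM.inv.posSemidef.nonneg
  rw [star_eq_conjTranspose] at hB
  have hMu : IsUnit M.det := hM.det_pos.ne'.isUnit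
  have hMinv : IsUnit (M⁻¹).det := hM.inv.det_pos.ne'.isUnit
  have hS : Bᵀ * Bᵀᵀ = M⁻¹ := by
    rw [hB, conjTranspose_eq_transpose_of_trivial, transpose_transpose]
  have hSu : IsUnit (Bᵀ).det := by
    rw [← hS, det_mul] at hMinv
    exact isUnit_of_mul_isUnit_left hMinv
  -- Both norm identities are the C*-identity, applied to `S Sᵀ = M⁻¹` and to `(S⁻¹)ᵀ S⁻¹ = M`.
  refine ⟨Bᵀ, hSu, hS, ?_, ?_⟩
  · rw [← hS, map_mul, sq, ← CStarRing.norm_self_mul_star, ← map_star, star_eq_conjTranspose,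
      conjTranspose_eq_transpose_of_trivial]
  · have h1 : (Bᵀ⁻¹)ᵀ * Bᵀ⁻¹ = M := by
      rw [transpose_nonsing_inv, ← Matrix.mul_inv_rev, hS, nonsing_inv_nonsing_inv _ hMu]
    conv_rhs => rw [← h1]
    rw [map_mul, sq, ← CStarRing.norm_star_mul_self, ← map_star, star_eq_conjTranspose,
      conjTranspose_eq_transpose_of_trivial]

end MatrixBounds

variable {X Ω : Type*} [MeasurableSpace X] [TopologicalSpace Ω] {k : ℕ}
  {φ ψ : OpenPartialHomeomorph Ω (EuclideanSpace ℝ (Fin k))}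

theorem posDef_jacobian (hφ : IsGlobalCoord φ) (hψ : IsGlobalCoord ψ) (h : IsC2Related φ ψ)
    (θ : Ω) {M : Matrix (Fin k) (Fin k) ℝ} (hM : M.PosDef) :
    ((jacobian φ ψ θ)ᵀ * M * jacobian φ ψ θ).PosDef := by
  rw [← conjTranspose_eq_transpose_of_trivial]
  refine hM.conjTranspose_mul_mul_same (Function.LeftInverse.injective
    (g := (jacobian ψ φ θ).mulVec) fun v => ?_)
  rw [mulVec_mulVec, jacobian_mul_jacobian hψ hφ h.symm, one_mulVec]

/-- The pulled-back Lebesgue measure is finite on compact sets, so condition 3 is a consequence of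
compactness and continuity. -/
theorem integrableOn_comap_of_continuousOn [MeasurableSpace Ω] [BorelSpace Ω]
    (hψ : IsGlobalCoord ψ) {Θ : Set Ω} (hΘ : IsCompact Θ) {f : Ω → ℝ} (hf : ContinuousOn f Θ) :
    IntegrableOn f Θ ((volume : Measure (EuclideanSpace ℝ (Fin k))).comap ψ) := by
  have hemb : IsOpenEmbedding ψ := ψ.isOpenEmbedding hψ
  have : T2Space Ω := hemb.isEmbedding.t2Space
  have : IsFiniteMeasureOnCompacts
      ((volume : Measure (EuclideanSpace ℝ (Fin k))).comap ψ) := by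
    refine ⟨fun K hK => ?_⟩
    rw [hemb.measurableEmbedding.comap_apply]
    exact (hK.image hemb.continuous).measure_lt_top
  exact hf.integrableOn_compact hΘ

end

end MDL

/-! ### Boundaries of preimages and uniform differentiability. -/

section Calculus

theorem frontier_inter_preimage_subset {α β : Type*} [TopologicalSpace α] [TopologicalSpace β]
    {s : Set α} (hs : IsOpen s) {h : α → β} (hc : ContinuousOn h s) (A : Set β) :
    frontier (s ∩ h ⁻¹' A) ⊆ frontier s ∪ (s ∩ h ⁻¹' (frontier A)) := by
  intro x hx
  have hxs : x ∈ closure s := closure_mono Set.inter_subset_left hx.1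
  by_cases hx' : x ∈ s
  · refine Or.inr ⟨hx', ?_, ?_⟩
    · by_contra hA
      obtain ⟨z, hz1, hz2⟩ := mem_closure_iff.1 hx.1 _
        (hc.isOpen_inter_preimage hs isClosed_closure.isOpen_compl) ⟨hx', hA⟩
      exact hz1.2 (subset_closure hz2.2)
    · intro hA
      exact hx.2 (interior_maximal
        (Set.inter_subset_inter_right _ (Set.preimage_mono interior_subset))
        (hc.isOpen_inter_preimage hs isOpen_interior) ⟨hx', hA⟩)
  · exact Or.inl ⟨hxs, fun h' => hx' (interior_subset h')⟩

variable {E F : Type*} [NormedAddCommGroup E] [NormedSpace ℝ E]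
  [NormedAddCommGroup F] [NormedSpace ℝ F]

/-- Uniform differentiability of a `C¹` function along a compact set. -/
theorem IsCompact.exists_uniform_hasFDerivAt {f : E → F} {K U : Set E} (hK : IsCompact K)
    (hU : IsOpen U) (hKU : K ⊆ U) (hf : ContDiffOn ℝ 1 f U) {η : ℝ} (hη : 0 < η) :
    ∃ r : ℝ, 0 < r ∧ ∀ y ∈ K, Metric.ball y r ⊆ U ∧ ∀ z ∈ Metric.ball y r,
      ‖fderiv ℝ f z - fderiv ℝ f y‖ ≤ η ∧ ‖f z - f y - fderiv ℝ f y (z - y)‖ ≤ η * ‖z - y‖ := by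
  obtain ⟨r₁, hr₁, hr₁U⟩ := hK.exists_thickening_subset_open hU hKU
  have hc := hf.continuousOn_fderiv_of_isOpen hU le_rfl
  obtain ⟨r₂, hr₂, hr₂η⟩ := Metric.mem_uniformity_dist.1 (hK.uniformContinuousAt_of_continuousAt
    (fderiv ℝ f) (fun a ha => hc.continuousAt (hU.mem_nhds (hKU ha))) (Metric.dist_mem_uniformity hη))
  refine ⟨min r₁ r₂, by positivity, fun y hy => ?_⟩
  have hb1 : Metric.ball y (min r₁ r₂) ⊆ U := fun z hz => hr₁U
    (Metric.mem_thickening_iff.2 ⟨y, hy, (Metric.mem_ball.1 hz).trans_le (min_le_left _ _)⟩)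
  have hb2 : ∀ z ∈ Metric.ball y (min r₁ r₂), ‖fderiv ℝ f z - fderiv ℝ f y‖ ≤ η := by
    intro z hz
    have h1 : dist y z < r₂ := by
      rw [dist_comm]; exact (Metric.mem_ball.1 hz).trans_le (min_le_right _ _)
    have h2 : dist (fderiv ℝ f y) (fderiv ℝ f z) < η := hr₂η h1 hy
    rw [← dist_eq_norm, dist_comm]
    exact h2.le
  refine ⟨hb1, fun z hz => ⟨hb2 z hz, ?_⟩⟩
  refine (convex_ball y (min r₁ r₂)).norm_image_sub_le_of_norm_hasFDerivWithin_le'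
    (f' := fderiv ℝ f) (fun w hw => ?_) hb2 (Metric.mem_ball_self (by positivity)) hz
  exact ((hf.contDiffAt (hU.mem_nhds (hb1 hw))).differentiableAt
    (by simp)).hasFDerivAt.hasFDerivWithinAt

end Calculus

namespace MDL

open Matrix

noncomputable section

variable {X Ω : Type*} [MeasurableSpace X] [TopologicalSpace Ω] {k : ℕ}
  {φ ψ : OpenPartialHomeomorph Ω (EuclideanSpace ℝ (Fin k))}

/-- The set of rescaled `φ`-errors `z` for which the corresponding rescaled `ψ`-error lies in `A`
has a null boundary, within any convex open set of errors on which it is defined. -/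
theorem volume_frontier_rescaled (hψ : IsGlobalCoord ψ)
    (h : IsC2Related φ ψ) (θ : Ω) {t : ℝ} (ht : 0 < t) {s : Set (EuclideanSpace ℝ (Fin k))}
    (hs : IsOpen s) (hsc : Convex ℝ s) (hsU : ∀ z ∈ s, φ θ + t⁻¹ • z ∈ φ.target)
    {A : Set (EuclideanSpace ℝ (Fin k))} (hA : volume (frontier A) = 0) :
    volume (frontier (s ∩ (fun z => t • ((ψ ∘ φ.symm) (φ θ + t⁻¹ • z) - ψ θ)) ⁻¹' A)) = 0 := by
  have hcont : ContinuousOn (fun z => t • ((ψ ∘ φ.symm) (φ θ + t⁻¹ • z) - ψ θ)) s := by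
    have h1 : ContinuousOn (fun z => (ψ ∘ φ.symm) (φ θ + t⁻¹ • z)) s :=
      h.contDiffOn_forward.continuousOn.comp (by fun_prop) hsU
    exact (h1.sub continuousOn_const).const_smul t
  refine measure_mono_null (frontier_inter_preimage_subset hs hcont A)
    (measure_union_null (hsc.addHaar_frontier volume) ?_)
  -- The pulled-back frontier lies in the image of this null set under the inverse rescaled map, and
  -- differentiable maps preserve null sets.
  set N := frontier A ∩ {w | ψ θ + t⁻¹ • w ∈ ψ.target}
  have hN : volume N = 0 := measure_mono_null Set.inter_subset_left hA
  have hd : DifferentiableOn ℝ (fun w => t • ((φ ∘ ψ.symm) (ψ θ + t⁻¹ • w) - φ θ)) N := by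
    have h1 : DifferentiableOn ℝ (fun w => (φ ∘ ψ.symm) (ψ θ + t⁻¹ • w)) N :=
      (h.contDiffOn_backward.differentiableOn (by simp)).comp (by fun_prop) fun w hw => hw.2
    exact (h1.sub_const _).const_smul t
  refine measure_mono_null ?_ (addHaar_image_eq_zero_of_differentiableOn_of_addHaar_eq_zero
    volume hd hN)
  rintro z ⟨hz, hzA⟩
  have h2 : ψ θ + t⁻¹ • t • ((ψ ∘ φ.symm) (φ θ + t⁻¹ • z) - ψ θ) =
      (ψ ∘ φ.symm) (φ θ + t⁻¹ • z) := by
    rw [inv_smul_smul₀ ht.ne', add_sub_cancel]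
  refine ⟨_, ⟨hzA, ?_⟩, ?_⟩
  · rw [Set.mem_ofPred_eq, h2]
    exact hψ.mem_target _
  · simp only [h2]
    simp only [Function.comp_apply, hψ.symm_apply]
    rw [φ.right_inv (hsU z hz), add_sub_cancel_left, smul_inv_smul₀ ht.ne']

end

end MDL

/-! ### Transfer of uniform asymptotic normality. -/

namespace MDL

open Matrix

noncomputable section

section Rescaled

variable {E : Type*} [NormedAddCommGroup E] [NormedSpace ℝ E]

/-- In coordinates in which its linearization at `y` is the identity, a rescaled function whose
derivative varies little is `C¹`-close to the identity. -/
theorem rescaled_close_id {f : E → E} {y : E} {r η C R t : ℝ} {S S' L' : E →L[ℝ] E}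
    (hd : ∀ z ∈ Metric.ball y r, DifferentiableAt ℝ f z)
    (hf : ∀ z ∈ Metric.ball y r, ‖fderiv ℝ f z - fderiv ℝ f y‖ ≤ η ∧
      ‖f z - f y - fderiv ℝ f y (z - y)‖ ≤ η * ‖z - y‖)
    (hL : L' ∘L fderiv ℝ f y = ContinuousLinearMap.id ℝ E)
    (hS : S' ∘L S = ContinuousLinearMap.id ℝ E) (hη : 0 ≤ η) (hC : 0 < C)
    (hSC : ‖S‖ ≤ C) (hS'C : ‖S'‖ ≤ C) (hL'C : ‖L'‖ ≤ C) (hR : 0 < R) (ht : 0 < t)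
    (htr : C * R ≤ t * r) {x : E} (hx : x ∈ Metric.ball 0 R) :
    y + t⁻¹ • S x ∈ Metric.ball y r ∧
    HasFDerivAt (fun x => S' (L' (t • (f (y + t⁻¹ • S x) - f y))))
      (S' ∘L L' ∘L fderiv ℝ f (y + t⁻¹ • S x) ∘L S) x ∧
    ‖S' (L' (t • (f (y + t⁻¹ • S x) - f y))) - x‖ ≤ C ^ 3 * η * R ∧
    ‖S' ∘L L' ∘L fderiv ℝ f (y + t⁻¹ • S x) ∘L S - ContinuousLinearMap.id ℝ E‖ ≤ C ^ 3 * η := by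
  have hxR : ‖x‖ < R := by simpa using hx
  have hSx : ‖S x‖ ≤ C * ‖x‖ := S.le_of_opNorm_le hSC x
  have hLy : ∀ v, L' (fderiv ℝ f y v) = v := fun v => by
    simpa using DFunLike.congr_fun hL v
  have hSy : ∀ v, S' (S v) = v := fun v => by
    simpa using DFunLike.congr_fun hS v
  have hz : y + t⁻¹ • S x ∈ Metric.ball y r := by
    rw [Metric.mem_ball, dist_eq_norm, add_sub_cancel_left, norm_smul, norm_inv, Real.norm_eq_abs,
      abs_of_pos ht, inv_mul_lt_iff₀ ht]
    exact (hSx.trans_lt (by gcongr)).trans_le htr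
  have hT : ∀ v, ‖S' (L' v)‖ ≤ C * (C * ‖v‖) := fun v =>
    (S'.le_of_opNorm_le hS'C _).trans (by gcongr; exact L'.le_of_opNorm_le hL'C _)
  refine ⟨hz, ?_, ?_, ?_⟩
  · have h1 : HasFDerivAt (fun x => y + t⁻¹ • S x) (t⁻¹ • S) x :=
      (S.hasFDerivAt.const_smul t⁻¹).const_add y
    have h2 := (hd _ hz).hasFDerivAt.comp x h1
    have h3 := (S' ∘L L').hasFDerivAt.comp x ((h2.sub_const (f y)).const_smul t)
    refine h3.congr_fderiv ?_
    ext v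
    simp [ht.ne']
  -- The linear part of the increment is sent exactly to `x`, so only the Taylor remainder survives.
  · have h1 : S' (L' (t • (f (y + t⁻¹ • S x) - f y))) - x =
        S' (L' (t • (f (y + t⁻¹ • S x) - f y - fderiv ℝ f y ((y + t⁻¹ • S x) - y)))) := by
      rw [add_sub_cancel_left, smul_sub t _ (fderiv ℝ f y _), map_sub, map_sub, map_smul _ t⁻¹,
        smul_inv_smul₀ ht.ne', hLy, hSy]
    rw [h1]
    have h2 := (hf _ hz).2
    rw [add_sub_cancel_left, norm_smul, norm_inv, Real.norm_eq_abs, abs_of_pos ht] at h2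
    refine (hT _).trans ?_
    rw [norm_smul, Real.norm_eq_abs, abs_of_pos ht, add_sub_cancel_left]
    calc C * (C * (t * ‖f (y + t⁻¹ • S x) - f y - fderiv ℝ f y (t⁻¹ • S x)‖))
        ≤ C * (C * (t * (η * (t⁻¹ * (C * R))))) := by
          gcongr
          refine h2.trans ?_
          gcongr
          exact hSx.trans (by gcongr)
      _ = C ^ 3 * η * R := by field_simp
  · refine ContinuousLinearMap.opNorm_le_bound _ (by positivity) fun v => ?_
    have h1 : (S' ∘L L' ∘L fderiv ℝ f (y + t⁻¹ • S x) ∘L S - ContinuousLinearMap.id ℝ E) v =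
        S' (L' ((fderiv ℝ f (y + t⁻¹ • S x) - fderiv ℝ f y) (S v))) := by
      simp [hLy, hSy]
    rw [h1]
    calc _ ≤ C * (C * ‖(fderiv ℝ f (y + t⁻¹ • S x) - fderiv ℝ f y) (S v)‖) := hT _
      _ ≤ C * (C * (η * (C * ‖v‖))) := by
          gcongr
          refine (ContinuousLinearMap.le_of_opNorm_le _ (hf _ hz).1 _).trans ?_
          gcongr
          exact S.le_of_opNorm_le hSC v
      _ = C ^ 3 * η * ‖v‖ := by ring

end Rescaled

variable {X Ω : Type*} [MeasurableSpace X] [TopologicalSpace Ω] {k : ℕ}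
  {φ ψ : OpenPartialHomeomorph Ω (EuclideanSpace ℝ (Fin k))}
  {vol : Measure X} {p : (n : ℕ) → (Fin n → X) → Ω → ℝ}
  {θhat : (n : ℕ) → (Fin n → X) → Ω} {Θ : Set Ω}

theorem uniformAsymptoticNormality_of_isC2Related (hφ : IsGlobalCoord φ) (hψ : IsGlobalCoord ψ)
    (h : IsC2Related φ ψ) (hp : IsStatModel vol p φ) (hΘ : IsCompact Θ)
    (hI : ContinuousOn (fisherInfo vol p φ) Θ)
    (hIψ : ∀ θ ∈ Θ, fisherInfo vol p ψ θ =
      (jacobian φ ψ θ)ᵀ * fisherInfo vol p φ θ * jacobian φ ψ θ)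
    (hN : UniformAsymptoticNormality vol p θhat φ Θ) :
    UniformAsymptoticNormality vol p θhat ψ Θ := by
  refine ⟨fun θ hθ => hIψ θ hθ ▸ posDef_jacobian hφ hψ h θ (hN.posDef θ hθ), ?_⟩
  intro ε hε
  obtain ⟨R, δ, hR, hδ, hRball, hpert⟩ := exists_stdGaussian_perturbation
    (E := EuclideanSpace ℝ (Fin k)) (ε := ε / 5) (by positivity)
  obtain ⟨N₀, hN₀⟩ := hN.uniform (ε / 5) (by positivity)
  -- uniform bounds
  obtain ⟨C₁, hC₁, hC₁'⟩ := exists_norm_toEuclideanCLM_le hΘ hI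
  obtain ⟨C₂, hC₂, hC₂'⟩ := exists_norm_toEuclideanCLM_le hΘ
    (continuousOn_matrix_inv hI fun θ hθ => (hN.posDef θ hθ).det_pos.ne')
  obtain ⟨C₃, hC₃, hC₃'⟩ := exists_norm_toEuclideanCLM_le hΘ
    (continuous_jacobian hψ h).continuousOn
  set C : ℝ := max (max (√C₁) (√C₂)) C₃
  have hC : 0 < C := lt_max_of_lt_right hC₃
  -- Chosen so that both bounds of `rescaled_close_id` are at most `δ`; the three factors `C` bound
  -- the whitening map, its inverse and the Jacobian.
  set η : ℝ := min (δ / (C ^ 3 * R)) (δ / C ^ 3)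
  have hη : 0 < η := by positivity
  have hη1 : C ^ 3 * η * R ≤ δ := by
    have : η ≤ δ / (C ^ 3 * R) := min_le_left _ _
    rw [le_div_iff₀ (by positivity)] at this
    linarith
  have hη2 : C ^ 3 * η ≤ δ := by
    have : η ≤ δ / C ^ 3 := min_le_right _ _
    rw [le_div_iff₀ (by positivity)] at this
    linarith
  obtain ⟨r, hr, hrK⟩ := (hΘ.image hφ.continuous).exists_uniform_hasFDerivAt φ.open_target
    (by rintro _ ⟨θ, -, rfl⟩; exact hφ.mem_target θ)
    (h.contDiffOn_forward.of_le (by norm_num)) hη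
  -- From here on `√n * r ≥ C * R`, so the rescaled ellipsoid fits into the ball of radius `r` about
  -- `φ θ`.
  obtain ⟨N₁, hN₁⟩ := exists_nat_gt ((C * R / r) ^ 2)
  refine ⟨max (max N₀ N₁) 1, fun n θ hθ A hA hAf hn => ?_⟩
  have hnN₀ : N₀ ≤ n := (le_max_left _ _).trans ((le_max_left _ _).trans hn)
  have hnN₁ : N₁ ≤ n := (le_max_right _ _).trans ((le_max_left _ _).trans hn)
  have hn1 : 1 ≤ n := (le_max_right _ _).trans hn
  set t : ℝ := √(n : ℝ)
  have ht : 0 < t := Real.sqrt_pos.2 (by exact_mod_cast hn1)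
  have htr : C * R ≤ t * r := by
    rw [← div_le_iff₀ hr]
    refine Real.le_sqrt_of_sq_le (hN₁.le.trans ?_)
    exact_mod_cast hnN₁
  obtain ⟨hball, hrf⟩ := hrK _ ⟨θ, hθ, rfl⟩
  obtain ⟨S, hSu, hSI, hSn, hSn'⟩ := exists_mul_transpose_eq_inv (hN.posDef θ hθ)
  -- the linear maps involved
  set s := toEuclideanCLM (𝕜 := ℝ) S with hs
  set s' := toEuclideanCLM (𝕜 := ℝ) S⁻¹ with hs'
  set l' := toEuclideanCLM (𝕜 := ℝ) (jacobian φ ψ θ) with hl'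
  set f := ψ ∘ φ.symm with hf
  have hfθ : f (φ θ) = ψ θ := by simp [hf, hφ.symm_apply]
  have hl : fderiv ℝ f (φ θ) = toEuclideanCLM (𝕜 := ℝ) (jacobian ψ φ θ) :=
    (toEuclideanCLM_jacobian θ).symm
  have hl'l : l' ∘L fderiv ℝ f (φ θ) = ContinuousLinearMap.id ℝ _ := by
    rw [hl, ← ContinuousLinearMap.mul_def, ← map_mul, jacobian_mul_jacobian hφ hψ h, map_one]
    rfl
  have hs's : s' ∘L s = ContinuousLinearMap.id ℝ _ := by
    rw [← ContinuousLinearMap.mul_def, ← map_mul, nonsing_inv_mul _ hSu, map_one]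
    rfl
  have hss' : s ∘L s' = ContinuousLinearMap.id ℝ _ := by
    rw [← ContinuousLinearMap.mul_def, ← map_mul, mul_nonsing_inv _ hSu, map_one]
    rfl
  have hsC : ‖s‖ ≤ C := (Real.le_sqrt_of_sq_le (hSn.trans_le (hC₂' θ hθ))).trans
    ((le_max_right _ _).trans (le_max_left _ _))
  have hs'C : ‖s'‖ ≤ C := (Real.le_sqrt_of_sq_le (hSn'.trans_le (hC₁' θ hθ))).trans
    ((le_max_left _ _).trans (le_max_left _ _))
  have hl'C : ‖l'‖ ≤ C := (hC₃' θ hθ).trans (le_max_right _ _)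
  have hclose := fun x hx => rescaled_close_id (f := f) (y := φ θ)
    (fun z hz => (h.symm.contDiffAt (hball hz)).differentiableAt (by simp)) hrf hl'l hs's hη.le hC
    hsC hs'C hl'C hR ht htr (x := x) hx
  set B : Set (EuclideanSpace ℝ (Fin k)) := Metric.ball 0 R
  set H : EuclideanSpace ℝ (Fin k) → EuclideanSpace ℝ (Fin k) :=
    fun z => t • (f (φ θ + t⁻¹ • z) - ψ θ) with hH
  set B' : Set (EuclideanSpace ℝ (Fin k)) := s' ⁻¹' B with hB'
  have hs'x : ∀ x, s' (s x) = x := fun x => by simpa using DFunLike.congr_fun hs's x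
  have hsx' : ∀ x, s (s' x) = x := fun x => by simpa using DFunLike.congr_fun hss' x
  have hlx' : ∀ x, fderiv ℝ f (φ θ) (l' x) = x := fun x => by
    have : fderiv ℝ f (φ θ) ∘L l' = ContinuousLinearMap.id ℝ _ := by
      rw [hl, ← ContinuousLinearMap.mul_def, ← map_mul, jacobian_mul_jacobian hψ hφ h.symm, map_one]
      rfl
    simpa using DFunLike.congr_fun this x
  -- `K` is `H` in whitened coordinates: `T ∘ K = H ∘ s`, where `s` and `T` carry the standard
  -- Gaussian to the limit laws in `φ` and `ψ`.
  set K := fun x => s' (l' (t • (f (φ θ + t⁻¹ • s x) - f (φ θ)))) with hK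
  set T := toEuclideanCLM (𝕜 := ℝ) (jacobian ψ φ θ * S) with hT
  have hTK : ∀ x, T (K x) = H (s x) := fun x => by
    rw [hT, map_mul, ← hl, ← hs, ContinuousLinearMap.mul_def, ContinuousLinearMap.comp_apply, hK]
    simp only
    rw [hsx', hlx', hfθ]
  have hB'U : ∀ z ∈ B', φ θ + t⁻¹ • z ∈ φ.target := fun z hz => by
    have := hball (hclose (s' z) hz).1
    rwa [hsx'] at this
  have hB'o : IsOpen B' := Metric.isOpen_ball.preimage s'.continuous
  have hB'c : Convex ℝ B' := (convex_ball 0 R).is_linear_preimage s'.isLinear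
  have hHc : ContinuousOn H B' := by
    have h1 : ContinuousOn (fun z => f (φ θ + t⁻¹ • z)) B' :=
      h.contDiffOn_forward.continuousOn.comp (by fun_prop) hB'U
    exact (h1.sub continuousOn_const).const_smul t
  have hDm : MeasurableSet (B' ∩ H ⁻¹' A) :=
    hHc.measurableSet_inter_preimage hB'o.measurableSet hA
  have hinj : Set.InjOn K B := by
    intro x hx x' hx' hxx'
    have h1 : H (s x) = H (s x') := by rw [← hTK, ← hTK, hxx']
    have h2 : f (φ θ + t⁻¹ • s x) = f (φ θ + t⁻¹ • s x') := by
      simpa [hH, ht.ne'] using h1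
    have h3 := congrArg ψ.symm h2
    simp only [hf, Function.comp_apply, hψ.symm_apply] at h3
    have h4 := φ.symm.injOn (hball (hclose x hx).1) (hball (hclose x' hx').1) h3
    have h5 : s x = s x' := by simpa [ht.ne'] using h4
    rw [← hs'x x, h5, hs'x]
  have hpre : B ∩ K ⁻¹' (T ⁻¹' A) = s ⁻¹' (B' ∩ H ⁻¹' A) := by
    ext x
    simp only [Set.mem_inter_iff, Set.mem_preimage, hTK, hB', hs'x]
  have e1 := hpert K _ (fun x hx => (hclose x hx).2.1) hinj
    (fun x hx => (hclose x hx).2.2.1.trans hη1) (fun x hx => (hclose x hx).2.2.2.trans hη2)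
    (T ⁻¹' A) (T.continuous.measurable hA)
  have hTI : (jacobian ψ φ θ * S) * (jacobian ψ φ θ * S)ᵀ = (fisherInfo vol p ψ θ)⁻¹ := by
    rw [hIψ θ hθ, Matrix.mul_inv_rev, Matrix.mul_inv_rev, ← hSI, ← transpose_nonsing_inv,
      inv_eq_left_inv (jacobian_mul_jacobian hψ hφ h.symm θ), transpose_mul]
    simp only [Matrix.mul_assoc]
  rw [hpre, ← real_multivariateGaussian_inv hSI _ hDm,
    ← real_multivariateGaussian_inv hTI _ hA] at e1
  have e2 := hN₀ n θ hθ _ hDm (volume_frontier_rescaled hψ h θ ht hB'o hB'c hB'U hAf) hnN₀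
  -- Condition 4 in `φ` also controls the tail: the error leaves `B'` with probability below `2ε/5`.
  -- With `ε/5` each from `e1` and `e2`, the total loss is at most `4ε/5`.
  have e3 := hN₀ n θ hθ B'ᶜ hB'o.measurableSet.compl
    (by rw [frontier_compl]; exact hB'c.addHaar_frontier volume) hnN₀
  have hB'pre : s ⁻¹' B'ᶜ = Bᶜ := by
    ext x
    simp only [Set.mem_preimage, Set.mem_compl_iff, hB', hs'x]
  rw [real_multivariateGaussian_inv hSI _ hB'o.measurableSet.compl, ← hs, hB'pre] at e3
  have hHz : ∀ x, H (t • (φ (θhat n x) - φ θ)) = t • (ψ (θhat n x) - ψ θ) := fun x => by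
    simp only [hH, hf, Function.comp_apply]
    rw [inv_smul_smul₀ ht.ne', add_sub_cancel, hφ.symm_apply]
  have := hp.isProbabilityMeasure_dataLaw hn1 θ
  have e4 : (dataLaw vol p n θ).real {x | t • (φ (θhat n x) - φ θ) ∈ B' ∩ H ⁻¹' A} ≤
      (dataLaw vol p n θ).real {x | t • (ψ (θhat n x) - ψ θ) ∈ A} :=
    measureReal_mono fun x hx => (hHz x ▸ hx.2 : t • (ψ (θhat n x) - ψ θ) ∈ A)
  have e5 : (dataLaw vol p n θ).real {x | t • (ψ (θhat n x) - ψ θ) ∈ A} ≤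
      (dataLaw vol p n θ).real {x | t • (φ (θhat n x) - φ θ) ∈ B' ∩ H ⁻¹' A} +
        (dataLaw vol p n θ).real {x | t • (φ (θhat n x) - φ θ) ∈ B'ᶜ} := by
    refine (measureReal_mono fun x hx => ?_).trans (measureReal_union_le _ _)
    by_cases hb : t • (φ (θhat n x) - φ θ) ∈ B'
    · exact Or.inl ⟨hb, (by rw [hHz]; exact hx : H (t • (φ (θhat n x) - φ θ)) ∈ A)⟩
    · exact Or.inr hb
  rw [abs_le] at e1
  rw [abs_lt] at e2 e3 ⊢
  constructor <;> linarith

end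

end MDL

/-! ### The regularity conditions in the new coordinates. -/

theorem mainTheorem4 {X Ω : Type*} [MeasurableSpace X]
    [TopologicalSpace Ω] [MeasurableSpace Ω] [BorelSpace Ω] {k : ℕ}
    (vol : Measure X) [SigmaFinite vol]
    (p : (n : ℕ) → (Fin n → X) → Ω → ℝ) (θhat : (n : ℕ) → (Fin n → X) → Ω) (Θ : Set Ω)
    (φ ψ : OpenPartialHomeomorph Ω (EuclideanSpace ℝ (Fin k)))
    (hφ : MDL.IsGlobalCoord φ) (hψ : MDL.IsGlobalCoord ψ) (hφψ : MDL.IsC2Related φ ψ)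
    (hp : MDL.IsStatModel vol p φ) (hdiff : MDL.DiffUnderIntegral vol p φ Θ)
    (hmle : MDL.IsMLE p θhat)
    (h : MDL.RegularityConditions vol p θhat φ Θ) :
    MDL.RegularityConditions vol p θhat ψ Θ := by
  have hI : ∀ θ ∈ Θ, MDL.fisherInfo vol p ψ θ =
      (MDL.jacobian φ ψ θ).transpose * MDL.fisherInfo vol p φ θ * MDL.jacobian φ ψ θ :=
    fun θ hθ => MDL.fisherInfo_eq hφ hψ hφψ hp hdiff hθ (h.fisherInfo_exists θ hθ)
  have hJ := MDL.continuous_jacobian hψ hφψ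
  have hcont : ContinuousOn (MDL.fisherInfo vol p ψ) Θ := by
    refine ContinuousOn.congr (f := fun θ => (MDL.jacobian φ ψ θ).transpose *
      MDL.fisherInfo vol p φ θ * MDL.jacobian φ ψ θ) ?_ hI
    exact (hJ.matrix_transpose.continuousOn.mul h.continuousOn).mul hJ.continuousOn
  have hdet : ContinuousOn (fun θ => (MDL.fisherInfo vol p ψ θ).det) Θ :=
    (continuous_id.matrix_det (n := Fin k) (R := ℝ)).comp_continuousOn hcont
  have hnorm := MDL.uniformAsymptoticNormality_of_isC2Related hφ hψ hφψ hp h.isCompact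
    h.continuousOn hI h.asymptoticNormality
  refine ⟨fun θ hθ => MDL.fisherInfoExists_of_isC2Related hφ hψ hφψ hp hdiff hθ
    (h.fisherInfo_exists θ hθ), h.isCompact, ?_, hcont,
    MDL.integrableOn_comap_of_continuousOn hψ h.isCompact hdet.sqrt, hnorm, ?_⟩
  · rcases Θ.eq_empty_or_nonempty with rfl | hne
    · exact ⟨1, 1, one_pos, by simp⟩
    · obtain ⟨a, ha, hmin⟩ := h.isCompact.exists_isMinOn hne hdet
      obtain ⟨b, hb, hmax⟩ := h.isCompact.exists_isMaxOn hne hdet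
      -- The minimum of the determinant is positive because `I_ψ` is positive definite at the
      -- minimizer.
      exact ⟨_, _, (hnorm.posDef a ha).det_pos, fun θ hθ => ⟨hmin hθ, hmax hθ⟩⟩
  · obtain ⟨C₀, hC₀, hbound⟩ := h.hessian_bound
    obtain ⟨c, hc, hcb⟩ := MDL.exists_norm_toEuclideanCLM_le h.isCompact
      (M := fun θ => (MDL.jacobian φ ψ θ).transpose * C₀ * MDL.jacobian φ ψ θ)
      ((hJ.matrix_transpose.mul continuous_const).mul hJ).continuousOn
    refine ⟨c • 1, Matrix.PosDef.one.smul hc, fun n hn x hx hθ => ?_⟩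
    have h1 := MDL.posDef_jacobian hφ hψ hφψ (θhat n x) (hbound n hn x hx hθ)
    have h2 := MDL.posSemidef_smul_one_sub
      (MDL.posDef_jacobian hφ hψ hφψ (θhat n x) hC₀).isHermitian (hcb _ hθ)
    -- The splitting is `c - I_ψ = (c - Jᵀ C₀ J) + Jᵀ (C₀ - I_φ) J`, with the informations taken at
    -- the estimate.
    convert Matrix.PosDef.posSemidef_add h2 h1 using 1
    rw [MDL.empInfo_eq_of_isMLEAt hφ hψ hφψ hp hn x hx, Matrix.mul_sub, Matrix.sub_mul]
    abel
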